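/- Banach algebras and Banach spaces are complex; Banach algebras need not be unital. Let $\Omega$ be a locally compact Hausdorff space and let $\mathcal U=\{\Omega,(A_t)_{t\in\Omega},\Theta\}$ be a continuous field of Banach algebras, i.e. each $A_t$ is a Banach algebra and $\Theta$ is a subalgebra of $\prod_{t\in\Omega}A_t$ such that (i) $\{x(t):x\in\Theta\}$ is dense in $A_t$ for every $t$; (ii) $t\mapsto\|x(t)\|$ is continuous for every $x\in\Theta$; (iii) if $x\in\prod_t A_t$ and for every $t\in\Omega$ and $\varepsilon>0$ there is $x'\in\Theta$ with $\|x(s)-x'(s)\|\le\varepsilon$ for all $s$ in some neighbourhood of $t$, then $x\in\Theta$. For $Y\subseteq\Omega$ let $\mathcal U|_Y$ be the continuous field over $Y$ with fibres $A_t$ $(t\in Y)$ whose continuous vector fields are those $x\in\prod_{t\in Y}A_t$ such that for every $t_0\in Y$ and $\varepsilon>0$ there is $x'\in\Theta$ with $\|x(t)-x'(t)\|\le\varepsilon$ for all $t\in Y$ near $t_0$. Suppose that $\mathcal U$ is locally trivial: every $t\in\Omega$ has an open neighbourhood $V$ for which there are a Banach algebra $B$ and isometric algebra isomorphisms $\phi_s:A_s\to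 B$ $(s\in V)$ such that a vector field $x$ over $V$ is a continuous vector field of $\mathcal U|_V$ if and only if $s\mapsto\phi_s(x(s))$ is a continuous map $V\to B$. Let $\mathcal A$ be the Banach algebra defined by $\mathcal U$: the set of all $x\in\Theta$ for which $\|x(t)\|$ vanishes at infinity on $\Omega$, with pointwise operations and the norm $\|x\|=\sup_{t\in\Omega}\|x(t)\|$. Suppose that $\mathcal A$ is left or right projective, i.e. that $P=\mathcal A$, as a left (respectively right) Banach module over itself, has the following property: for every left (right) Banach $\mathcal A$-module $Y$, every bounded module homomorphism $\varphi:Y\to P$ that has a right inverse which is a bounded linear operator has a right inverse which is a bounded module homomorphism. Let $\Theta^2$ be the linear span of $\{xy:x,y\in\Theta\}$, and let $\overline{\Theta^2}$ be its closure for uniform convergence on compact subsets of $\Omega$, i.e. the set of $p\in\prod_t A_t$ such that for every compact $K\subseteq\Omega$ and every $\varepsilon>0$ there is $q\in\Theta^2$ with $\|p(t)-q(t)\|\le\varepsilon$ for all $t\in K$. Suppose that there is a continuous field $p\in\Theta\cap\overline{\Theta^2}$ such that $p(t)\ne0$ for all $t\in\Omega$ and $\sup_{s\in\Omega}\|p(s)\|<\infty$.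 Then $\Omega$ is paracompact. -/

import Mathlib

open Filter Topology
open scoped ENNReal

universe u v

/-! ## Banach modules over a (not necessarily unital) complex Banach algebra -/

/-- A left Banach module structure on the Banach space `Y` over the Banach algebra `A`: a jointly
continuous (that is, bounded) bilinear map `A × Y → Y` with `(a b) · y = a · (b · y)`. -/
structure LeftBanachAction (A : Type*) (Y : Type*) [NonUnitalNormedRing A] [NormedSpace ℂ A]
    [NormedAddCommGroup Y] [NormedSpace ℂ Y] where
  act : A →L[ℂ] Y →L[ℂ] Y
  mul_act : ∀ (a b : A) (y : Y), act (a * b) y = act a (act b y)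

/-- A right Banach module structure; `act a y` stands for `y · a`, and `y · (a b) = (y · a) · b`. -/
structure RightBanachAction (A : Type*) (Y : Type*) [NonUnitalNormedRing A] [NormedSpace ℂ A]
    [NormedAddCommGroup Y] [NormedSpace ℂ Y] where
  act : A →L[ℂ] Y →L[ℂ] Y
  act_mul : ∀ (a b : A) (y : Y), act (a * b) y = act b (act a y)

/-- `P` is projective in the category of left Banach `A`-modules: every morphism of modules
`φ : Y → P` that has a right inverse `σ` as a bounded linear operator (such a `φ` is onto, so it is
an epimorphism) has a right inverse `ψ` which is a morphism of modules. Morphisms are the bounded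
module homomorphisms. The test modules `Y` range over the universe of `P` and `A`. -/
def LeftBanachAction.IsProjective {A : Type u} {P : Type v} [NonUnitalNormedRing A] [NormedSpace ℂ A]
    [NormedAddCommGroup P] [NormedSpace ℂ P] (m : LeftBanachAction A P) : Prop :=
  ∀ (Y : Type (max u v)) [NormedAddCommGroup Y] [NormedSpace ℂ Y] [CompleteSpace Y]
    (n : LeftBanachAction A Y) (φ : Y →L[ℂ] P),
    (∀ a y, φ (n.act a y) = m.act a (φ y)) →
    (∃ σ : P →L[ℂ] Y, φ.comp σ = ContinuousLinearMap.id ℂ P) →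
    ∃ ψ : P →L[ℂ] Y, (∀ a x, ψ (m.act a x) = n.act a (ψ x)) ∧
      φ.comp ψ = ContinuousLinearMap.id ℂ P

/-- Projectivity in the category of right Banach `A`-modules. -/
def RightBanachAction.IsProjective {A : Type u} {P : Type v} [NonUnitalNormedRing A] [NormedSpace ℂ A]
    [NormedAddCommGroup P] [NormedSpace ℂ P] (m : RightBanachAction A P) : Prop :=
  ∀ (Y : Type (max u v)) [NormedAddCommGroup Y] [NormedSpace ℂ Y] [CompleteSpace Y]
    (n : RightBanachAction A Y) (φ : Y →L[ℂ] P),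
    (∀ a y, φ (n.act a y) = m.act a (φ y)) →
    (∃ σ : P →L[ℂ] Y, φ.comp σ = ContinuousLinearMap.id ℂ P) →
    ∃ ψ : P →L[ℂ] Y, (∀ a x, ψ (m.act a x) = n.act a (ψ x)) ∧
      φ.comp ψ = ContinuousLinearMap.id ℂ P

section Regular

variable (A : Type*) [NonUnitalNormedRing A] [NormedSpace ℂ A] [IsScalarTower ℂ A A]
  [SMulCommClass ℂ A A]

/-- `A` as a left Banach module over itself. -/
noncomputable def LeftBanachAction.regular : LeftBanachAction A A where
  act := ContinuousLinearMap.mul ℂ A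
  mul_act a b y := by simp [mul_assoc]

/-- `A` as a right Banach module over itself. -/
noncomputable def RightBanachAction.regular : RightBanachAction A A where
  act := (ContinuousLinearMap.mul ℂ A).flip
  act_mul a b y := by simp [mul_assoc]

/-- The Banach algebra `A` is left projective. -/
def IsLeftProjectiveBanachAlgebra [CompleteSpace A] : Prop :=
  (LeftBanachAction.regular A).IsProjective

/-- The Banach algebra `A` is right projective. -/
def IsRightProjectiveBanachAlgebra [CompleteSpace A] : Prop :=
  (RightBanachAction.regular A).IsProjective

end Regular

/-! ## Continuous fields of Banach algebras -/

/-- A continuous field of (complex) Banach algebras over `Ω` with fibres `A t`. The space `Ω` is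
assumed to be locally compact and Hausdorff where the notion is used. -/
structure ContinuousField (Ω : Type*) [TopologicalSpace Ω] (A : Ω → Type*)
    [∀ t, NonUnitalNormedRing (A t)] [∀ t, NormedSpace ℂ (A t)] where
  /-- the algebra of continuous vector fields -/
  Θ : NonUnitalSubalgebra ℂ (∀ t, A t)
  dense_eval : ∀ t, Dense {a : A t | ∃ x ∈ Θ, x t = a}
  continuous_norm : ∀ x ∈ Θ, Continuous fun t => ‖x t‖
  mem_of_locally_approx : ∀ x : ∀ t, A t,
    (∀ t, ∀ ε > 0, ∃ x' ∈ Θ, ∀ᶠ s in 𝓝 t, ‖x s - x' s‖ ≤ ε) → x ∈ Θ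

namespace ContinuousField

section Basic

variable {Ω : Type*} [TopologicalSpace Ω] {A : Ω → Type*}
  [∀ t, NonUnitalNormedRing (A t)] [∀ t, NormedSpace ℂ (A t)]

/-- The vector field `x` over `Y ⊆ Ω` is continuous at the point `t₀` of `Y`. -/
def ContAt (U : ContinuousField Ω A) {Y : Set Ω} (x : ∀ t : Y, A t) (t₀ : Y) : Prop :=
  ∀ ε > 0, ∃ x' ∈ U.Θ, ∀ᶠ t : Y in 𝓝 t₀, ‖x t - x' t‖ ≤ ε

theorem ContAt.continuousAt_norm {U : ContinuousField Ω A} {Y : Set Ω} {x : ∀ t : Y, A t} {t₀ : Y}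
    (h : U.ContAt x t₀) : ContinuousAt (fun t => ‖x t‖) t₀ := by
  rw [Metric.continuousAt_iff']
  intro ε hε
  obtain ⟨x', hx', h1⟩ := h (ε / 4) (by positivity)
  have hc : Continuous fun t : Y => ‖x' t‖ :=
    (U.continuous_norm x' hx').comp continuous_subtype_val
  have h2 := Metric.continuousAt_iff'.1 (hc.continuousAt (x := t₀)) (ε / 4) (by positivity)
  have h0 := h1.self_of_nhds
  filter_upwards [h1, h2] with t ht1 ht2
  rw [Real.dist_eq, abs_lt] at *
  have a1 := abs_le.1 ((abs_norm_sub_norm_le (x t) (x' t)).trans ht1)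
  have a2 := abs_le.1 ((abs_norm_sub_norm_le (x t₀) (x' t₀)).trans h0)
  constructor <;> linarith [a1.1, a1.2, a2.1, a2.2, ht2.1, ht2.2]

theorem ContAt.add {U : ContinuousField Ω A} {Y : Set Ω} {x y : ∀ t : Y, A t} {t₀ : Y}
    (hx : U.ContAt x t₀) (hy : U.ContAt y t₀) : U.ContAt (x + y) t₀ := by
  intro ε hε
  obtain ⟨x', hx', h1⟩ := hx (ε / 2) (by positivity)
  obtain ⟨y', hy', h2⟩ := hy (ε / 2) (by positivity)
  refine ⟨x' + y', add_mem hx' hy', ?_⟩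
  filter_upwards [h1, h2] with t ht1 ht2
  calc ‖(x + y) t - (x' + y') t‖ = ‖(x t - x' t) + (y t - y' t)‖ := by
        congr 1; simp only [Pi.add_apply]; abel
    _ ≤ ε := (norm_add_le _ _).trans (by linarith)

theorem ContAt.smul {U : ContinuousField Ω A} {Y : Set Ω} {x : ∀ t : Y, A t} {t₀ : Y} (c : ℂ)
    (hx : U.ContAt x t₀) : U.ContAt (c • x) t₀ := by
  intro ε hε
  obtain ⟨x', hx', h1⟩ := hx (ε / (‖c‖ + 1)) (by positivity)
  refine ⟨c • x', U.Θ.smul_mem c hx', ?_⟩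
  filter_upwards [h1] with t ht1
  calc ‖(c • x) t - (c • x') t‖ = ‖c‖ * ‖x t - x' t‖ := by
        rw [← norm_smul]; congr 1; simp [smul_sub]
    _ ≤ (‖c‖ + 1) * (ε / (‖c‖ + 1)) := by gcongr; linarith
    _ = ε := by field_simp

theorem ContAt.mul {U : ContinuousField Ω A} {Y : Set Ω} {x y : ∀ t : Y, A t} {t₀ : Y}
    (hx : U.ContAt x t₀) (hy : U.ContAt y t₀) : U.ContAt (x * y) t₀ := by
  intro ε hε
  set M : ℝ := ‖x t₀‖ + ‖y t₀‖ + 1 with hM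
  have hMpos : 0 < M := by positivity
  have bx : ∀ᶠ t : Y in 𝓝 t₀, ‖x t‖ < M :=
    hx.continuousAt_norm.eventually_lt continuousAt_const
      (by rw [hM]; linarith [norm_nonneg (y t₀)])
  have bY : ∀ᶠ t : Y in 𝓝 t₀, ‖y t‖ < M :=
    hy.continuousAt_norm.eventually_lt continuousAt_const
      (by rw [hM]; linarith [norm_nonneg (x t₀)])
  set δ : ℝ := min 1 (ε / (2 * M + 1)) with hδ
  have hδpos : 0 < δ := lt_min one_pos (by positivity)
  obtain ⟨x', hx', h1⟩ := hx δ hδpos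
  obtain ⟨y', hy', h2⟩ := hy δ hδpos
  refine ⟨x' * y', mul_mem hx' hy', ?_⟩
  filter_upwards [bx, bY, h1, h2] with t b1 b2 ht1 ht2
  have hx'M : ‖x' t‖ ≤ M + 1 := by
    have := norm_sub_norm_le (x' t) (x t)
    rw [norm_sub_rev] at this
    linarith [min_le_left 1 (ε / (2 * M + 1))]
  calc ‖(x * y) t - (x' * y') t‖ = ‖(x t - x' t) * y t + x' t * (y t - y' t)‖ := by
        congr 1; simp only [Pi.mul_apply, sub_mul, mul_sub]; abel
    _ ≤ ‖x t - x' t‖ * ‖y t‖ + ‖x' t‖ * ‖y t - y' t‖ :=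
        (norm_add_le _ _).trans (add_le_add (norm_mul_le _ _) (norm_mul_le _ _))
    _ ≤ δ * M + (M + 1) * δ := by gcongr
    _ = (2 * M + 1) * δ := by ring
    _ ≤ (2 * M + 1) * (ε / (2 * M + 1)) := by gcongr; exact min_le_right _ _
    _ = ε := by field_simp

/-- The field `U|_Y` induced by `U` on `Y ⊆ Ω`: its continuous vector fields are the vector fields
over `Y` that are continuous at every point of `Y`. -/
def restrict (U : ContinuousField Ω A) (Y : Set Ω) : ContinuousField Y fun t : Y => A t where
  Θ :=
    { carrier := {x | ∀ t₀ : Y, U.ContAt x t₀}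
      add_mem' := fun hx hy t₀ => (hx t₀).add (hy t₀)
      zero_mem' := fun t₀ ε hε => ⟨0, zero_mem _, by simp [hε.le]⟩
      mul_mem' := fun hx hy t₀ => (hx t₀).mul (hy t₀)
      smul_mem' := fun c _ hx t₀ => (hx t₀).smul c }
  dense_eval t := by
    refine (U.dense_eval t).mono ?_
    rintro a ⟨x, hx, rfl⟩
    exact ⟨fun s : Y => x s, fun t₀ ε hε => ⟨x, hx, by simp [hε.le]⟩, rfl⟩
  continuous_norm x hx := continuous_iff_continuousAt.2 fun t => (hx t).continuousAt_norm
  mem_of_locally_approx x hx t₀ ε hε := by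
    obtain ⟨y, hy, h1⟩ := hx t₀ (ε / 2) (by positivity)
    obtain ⟨x', hx', h2⟩ := hy t₀ (ε / 2) (by positivity)
    refine ⟨x', hx', ?_⟩
    filter_upwards [h1, h2] with t ht1 ht2
    exact (norm_sub_le_norm_sub_add_norm_sub _ (y t) _).trans (by linarith)

/-- The constant field over `X` defined by the Banach algebra `B`: its continuous vector fields are
the continuous maps `X → B`. -/
def const (X : Type*) [TopologicalSpace X] (B : Type*) [NonUnitalNormedRing B] [NormedSpace ℂ B] :
    ContinuousField X fun _ => B where
  Θ :=
    { carrier := {x | Continuous x}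
      add_mem' := fun hx hy => Continuous.add hx hy
      zero_mem' := continuous_const
      mul_mem' := fun hx hy => Continuous.mul hx hy
      smul_mem' := fun c _ hx => Continuous.const_smul hx c }
  dense_eval t := by
    have : {a : B | ∃ x : X → B, Continuous x ∧ x t = a} = Set.univ :=
      Set.eq_univ_of_forall fun a => ⟨fun _ => a, continuous_const, rfl⟩
    exact this ▸ dense_univ
  continuous_norm x hx := Continuous.norm hx
  mem_of_locally_approx x hx := by
    refine continuous_iff_continuousAt.2 fun t => Metric.continuousAt_iff'.2 fun ε hε => ?_
    obtain ⟨y, hy, h1⟩ := hx t (ε / 4) (by positivity)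
    have h2 := Metric.continuousAt_iff'.1 (Continuous.continuousAt (x := t) hy) (ε / 4)
      (by positivity)
    have h0 := h1.self_of_nhds
    filter_upwards [h1, h2] with s hs1 hs2
    rw [← dist_eq_norm] at hs1 h0
    rw [dist_comm] at h0
    linarith [dist_triangle4 (x s) (y s) (y t) (x t)]

/-- An isomorphism of continuous fields of Banach algebras over the same space: a family of
isometric isomorphisms of Banach algebras of the fibres which transforms `Θ` into `Θ'`. -/
structure Iso {A' : Ω → Type*} [∀ t, NonUnitalNormedRing (A' t)] [∀ t, NormedSpace ℂ (A' t)]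
    (U : ContinuousField Ω A) (U' : ContinuousField Ω A') where
  φ : ∀ t, A t ≃ₗᵢ[ℂ] A' t
  map_mul : ∀ t (a b : A t), φ t (a * b) = φ t a * φ t b
  mem_iff : ∀ x : ∀ t, A t, x ∈ U.Θ ↔ (fun t => φ t (x t)) ∈ U'.Θ

end Basic

variable {Ω : Type u} [TopologicalSpace Ω] {A : Ω → Type v}
  [∀ t, NonUnitalNormedRing (A t)] [∀ t, NormedSpace ℂ (A t)]

/-- A trivial field: one that is isomorphic to the constant field defined by a Banach algebra. -/
def IsTrivial (U : ContinuousField Ω A) : Prop :=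
  ∃ (B : Type v) (_ : NonUnitalNormedRing B) (_ : NormedSpace ℂ B) (_ : IsScalarTower ℂ B B)
    (_ : SMulCommClass ℂ B B) (_ : CompleteSpace B), Nonempty (U.Iso (const Ω B))

/-- `U` is locally trivial: every point has an open neighbourhood `V` with `U|_V` trivial. -/
def IsLocallyTrivial (U : ContinuousField Ω A) : Prop :=
  ∀ t : Ω, ∃ V : Set Ω, IsOpen V ∧ t ∈ V ∧ (U.restrict V).IsTrivial

section SquareOfTheta

variable [∀ t, IsScalarTower ℂ (A t) (A t)] [∀ t, SMulCommClass ℂ (A t) (A t)]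

/-- `Θ²`, the linear span of the products `x y` with `x, y ∈ Θ`. -/
def thetaSq (U : ContinuousField Ω A) : Submodule ℂ (∀ t, A t) :=
  Submodule.span ℂ {z | ∃ x ∈ U.Θ, ∃ y ∈ U.Θ, z = x * y}

/-- The closure of `Θ²` for uniform convergence on the compact subsets of `Ω`. (It contains the
closure for uniform convergence on `Ω`.) -/
def closureThetaSq (U : ContinuousField Ω A) : Set (∀ t, A t) :=
  {p | ∀ K : Set Ω, IsCompact K → ∀ ε > 0, ∃ q ∈ U.thetaSq, ∀ t ∈ K, ‖p t - q t‖ ≤ ε}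

end SquareOfTheta

/-- Every continuous vector field whose norm vanishes at infinity is bounded. -/
theorem memℓp_of_vanishing (U : ContinuousField Ω A) {x : ∀ t, A t} (hx : x ∈ U.Θ)
    (h0 : Tendsto (fun t => ‖x t‖) (cocompact Ω) (𝓝 0)) : Memℓp x ∞ := by
  refine memℓp_infty ?_
  obtain ⟨K, hK, hKc⟩ := mem_cocompact.1 (h0.eventually (gt_mem_nhds one_pos))
  obtain ⟨M, hM⟩ := (hK.image (U.continuous_norm x hx)).bddAbove
  refine ⟨max M 1, ?_⟩
  rintro _ ⟨t, rfl⟩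
  by_cases ht : t ∈ K
  · exact le_max_of_le_left (hM ⟨t, ht, rfl⟩)
  · exact le_max_of_le_right (le_of_lt (hKc ht))

section SectionAlgebra

variable [∀ t, IsScalarTower ℂ (A t) (A t)] [∀ t, SMulCommClass ℂ (A t) (A t)]

/-- The Banach algebra defined by the continuous field `U`: the continuous vector fields `x` for
which `‖x t‖` vanishes at infinity, with pointwise operations and the norm `sup_t ‖x t‖`. It is
realized inside the algebra `lp A ∞` of all bounded vector fields with the supremum norm; no `x` is
lost, see `memℓp_of_vanishing`. -/
def sectionAlgebra (U : ContinuousField Ω A) : NonUnitalSubalgebra ℂ (lp A ∞) where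
  carrier := {x | (⇑x : ∀ t, A t) ∈ U.Θ ∧ Tendsto (fun t => ‖x t‖) (cocompact Ω) (𝓝 0)}
  add_mem' := by
    rintro x y ⟨hx, hx0⟩ ⟨hy, hy0⟩
    refine ⟨by rw [lp.coeFn_add]; exact add_mem hx hy, ?_⟩
    refine squeeze_zero (fun _ => norm_nonneg _) (fun t => ?_) (by simpa using hx0.add hy0)
    exact norm_add_le _ _
  zero_mem' := ⟨by rw [lp.coeFn_zero]; exact zero_mem _, by simp [tendsto_const_nhds]⟩
  mul_mem' := by
    rintro x y ⟨hx, hx0⟩ ⟨hy, hy0⟩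
    refine ⟨by rw [lp.infty_coeFn_mul]; exact mul_mem hx hy, ?_⟩
    refine squeeze_zero (fun _ => norm_nonneg _) (fun t => ?_) (by simpa using hx0.mul hy0)
    exact norm_mul_le _ _
  smul_mem' := by
    rintro c x ⟨hx, hx0⟩
    refine ⟨by rw [lp.coeFn_smul]; exact U.Θ.smul_mem c hx, ?_⟩
    refine squeeze_zero (fun _ => norm_nonneg _) (fun t => ?_)
      (by simpa using hx0.const_mul ‖c‖)
    exact (norm_smul c (x t)).le

noncomputable instance (U : ContinuousField Ω A) : NormedSpace ℂ U.sectionAlgebra where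
  norm_smul_le c x := norm_smul_le c (x : lp A ∞)

/-- The algebra defined by a continuous field is complete. -/
instance (U : ContinuousField Ω A) [∀ t, CompleteSpace (A t)] :
    CompleteSpace U.sectionAlgebra := by
  have hcl : IsClosed (U.sectionAlgebra : Set (lp A ∞)) := by
    refine isClosed_of_closure_subset fun x hx => ?_
    have happ : ∀ ε > 0, ∃ y ∈ U.sectionAlgebra, ∀ t, ‖x t - y t‖ ≤ ε := by
      intro ε hε
      obtain ⟨y, hy, hxy⟩ := Metric.mem_closure_iff.1 hx ε hε
      refine ⟨y, hy, fun t => ?_⟩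
      rw [dist_eq_norm] at hxy
      exact (lp.norm_apply_le_norm ENNReal.top_ne_zero (x - y) t).trans hxy.le
    refine ⟨U.mem_of_locally_approx _ fun t ε hε => ?_, ?_⟩
    · obtain ⟨y, hy, hxy⟩ := happ ε hε
      exact ⟨y, hy.1, Eventually.of_forall hxy⟩
    · rw [Metric.tendsto_nhds]
      intro ε hε
      obtain ⟨y, hy, hxy⟩ := happ (ε / 2) (by positivity)
      filter_upwards [(Metric.tendsto_nhds.1 hy.2) (ε / 2) (by positivity)] with t ht
      rw [Real.dist_0_eq_abs, abs_norm] at ht ⊢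
      linarith [hxy t, norm_sub_norm_le (x t) (y t)]
  exact hcl.isComplete.completeSpace_coe

end SectionAlgebra

end ContinuousField

/-! Write `E` for the section algebra. Projectivity splits the product map: there is a bounded `W`
from `E` to the projective tensor square of `E`, realized as the closed span of elementary tensors
in the dual of the bilinear forms. On products, `W` is a module map and a right inverse of
multiplication (`IsProjectiveFor.exists_isBilinSplitting`).

Let `h` be a bump function with `h s = 1`. The field `h² p` lies in the closed span of products,
since `p` is a limit of sums of products on the support of `h`. Test `W (h² p)` on forms `β` with
`‖β a b‖ ≤ ‖a s‖ ‖b t‖`, and call `s` and `t` linked if some such value exceeds `‖p s‖ / 2`. The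
module property makes the value independent of `h`.

Two estimates carry the proof. For `s` in a compact set, one bump serves all `s`, and approximating
`W (h² p)` by finitely many elementary tensors, whose factors vanish at infinity, confines the
linked `t` to a compact set (`exists_isCompact_of_linked`). In a local trivialization the forms `f
(φ_s (a s) φ_t (b t))` vary continuously with `(s, t)`, and at `s = t` the splitting property gives
`f (φ_s (p s))`, so nearby points are linked (`linked_near_diagonal`).

The chain components of the symmetrized relation are therefore open and σ-compact, which gives
paracompactness (`ParacompactSpace.of_symmetric_relation`). -/

set_option linter.unusedSectionVars false

/-! ### Splitting the product map of a projective algebra -/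

section ProjectiveSplitting

variable {E : Type u} [NormedAddCommGroup E] [NormedSpace ℂ E]

/-- Restriction of a bilinear action to an invariant subspace. -/
noncomputable def restrictAct {Y : Type*} [NormedAddCommGroup Y] [NormedSpace ℂ Y]
    (m : E →L[ℂ] Y →L[ℂ] Y) (S : Submodule ℂ Y) (h : ∀ x, ∀ y ∈ S, m x y ∈ S) :
    E →L[ℂ] S →L[ℂ] S :=
  LinearMap.mkContinuous₂
    (LinearMap.mk₂ ℂ (fun x (y : S) => (⟨m x y, h x y y.2⟩ : S))
      (fun _ _ _ => by ext; simp) (fun _ _ _ => by ext; simp)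
      (fun _ _ _ => by ext; simp) (fun _ _ _ => by ext; simp))
    ‖m‖ (fun x y => m.le_opNorm₂ x y)

/-- Projectivity of `E` as a module over itself, for the bounded associative product `μ`. -/
def IsProjectiveFor (μ : E →L[ℂ] E →L[ℂ] E) : Prop :=
  ∀ (Y : Type u) [NormedAddCommGroup Y] [NormedSpace ℂ Y] [CompleteSpace Y]
    (m : E →L[ℂ] Y →L[ℂ] Y) (φ : Y →L[ℂ] E),
    (∀ a b y, m (μ a b) y = m a (m b y)) → (∀ a y, φ (m a y) = μ a (φ y)) →
    (∃ σ : E →L[ℂ] Y, φ.comp σ = ContinuousLinearMap.id ℂ E) →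
    ∃ ψ : E →L[ℂ] Y, (∀ a x, ψ (μ a x) = m a (ψ x)) ∧ φ.comp ψ = ContinuousLinearMap.id ℂ E

/-- The lifting property for modules which are given as closed invariant subspaces. -/
theorem IsProjectiveFor.exists_lift {μ : E →L[ℂ] E →L[ℂ] E} (hproj : IsProjectiveFor μ)
    {Y : Type u} [NormedAddCommGroup Y] [NormedSpace ℂ Y] [CompleteSpace Y]
    (m : E →L[ℂ] Y →L[ℂ] Y) (hm : ∀ a b y, m (μ a b) y = m a (m b y))
    (φ : Y →L[ℂ] E) (hφ : ∀ a y, φ (m a y) = μ a (φ y))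
    (S : Submodule ℂ Y) (hS : IsClosed (S : Set Y)) (hinv : ∀ x, ∀ y ∈ S, m x y ∈ S)
    (σ : E →L[ℂ] Y) (hσS : ∀ x, σ x ∈ S) (hσ : ∀ x, φ (σ x) = x) :
    ∃ ψ : E →L[ℂ] Y, (∀ x, ψ x ∈ S) ∧ (∀ a x, ψ (μ a x) = m a (ψ x)) ∧ ∀ x, φ (ψ x) = x := by
  have hSc : CompleteSpace S := hS.isComplete.completeSpace_coe
  obtain ⟨ψ, hψ, hφψ⟩ := hproj S (restrictAct m S hinv) (φ.comp S.subtypeL)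
    (fun a b y => Subtype.ext (hm a b y)) (fun a y => hφ a y)
    ⟨σ.codRestrict S hσS, by ext x; exact hσ x⟩
  exact ⟨S.subtypeL.comp ψ, fun x => (ψ x).2, fun a x => congrArg Subtype.val (hψ a x),
    fun x => DFunLike.congr_fun hφψ x⟩

variable {D : Type u} [NormedAddCommGroup D] [NormedSpace ℂ D]

/-- The closed span of the pairs `(a ⊗ b, μ a b)`, for a bilinear map `⊗`. -/
noncomputable def tensorGraph (μ : E →L[ℂ] E →L[ℂ] E) (τ : E →L[ℂ] E →L[ℂ] D) :
    Submodule ℂ (D × E) :=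
  (Submodule.span ℂ {w | ∃ a b : E, w = (τ a b, μ a b)}).topologicalClosure

variable {μ : E →L[ℂ] E →L[ℂ] E} {τ : E →L[ℂ] E →L[ℂ] D}

theorem mem_tensorGraph (a b : E) : (τ a b, μ a b) ∈ tensorGraph μ τ :=
  Submodule.le_topologicalClosure _ (Submodule.subset_span ⟨a, b, rfl⟩)

theorem tensorGraph_le {S : Submodule ℂ (D × E)}
    (hS : IsClosed (S : Set (D × E))) (h : ∀ a b : E, (τ a b, μ a b) ∈ S) :
    tensorGraph μ τ ≤ S := by
  refine Submodule.topologicalClosure_minimal _ (Submodule.span_le.2 ?_) hS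
  rintro _ ⟨a, b, rfl⟩
  exact h a b

theorem tensorGraph_fst_mem {w : D × E} (hw : w ∈ tensorGraph μ τ) :
    w.1 ∈ (Submodule.span ℂ {u | ∃ a b : E, u = τ a b}).topologicalClosure := by
  set S := (Submodule.span ℂ {u | ∃ a b : E, u = τ a b}).topologicalClosure
  have : tensorGraph μ τ ≤ S.comap (LinearMap.fst ℂ D E) := by
    refine tensorGraph_le ?_ fun a b => ?_
    · exact (Submodule.isClosed_topologicalClosure _).preimage continuous_fst
    · exact Submodule.le_topologicalClosure _ (Submodule.subset_span ⟨a, b, rfl⟩)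
  exact this hw

/-- The second coordinate of the graph serves as the product of the first, so no product map on `D`
is needed. The identity holds on generators and extends by linearity and continuity. -/
theorem tensorGraph_apply {w : D × E} (hw : w ∈ tensorGraph μ τ) (l : D →L[ℂ] ℂ) (f : E →L[ℂ] ℂ)
    (h : ∀ a b, l (τ a b) = f (μ a b)) : l w.1 = f w.2 := by
  set L : D × E →L[ℂ] ℂ :=
    l.comp (ContinuousLinearMap.fst ℂ _ _) - f.comp (ContinuousLinearMap.snd ℂ _ _)
  have : tensorGraph μ τ ≤ L.toLinearMap.ker :=
    tensorGraph_le L.isClosed_ker fun a b => sub_eq_zero.2 (h a b)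
  exact sub_eq_zero.1 (this hw)

/-- By associativity the generator of `(a, b)` is sent to the generator of `(μ x a, b)`. -/
theorem act_mem_tensorGraph (hμ : ∀ a b c, μ (μ a b) c = μ a (μ b c))
    {δ : E →L[ℂ] D →L[ℂ] D} (hτ : ∀ x a b, δ x (τ a b) = τ (μ x a) b) (x : E) {w : D × E}
    (hw : w ∈ tensorGraph μ τ) : (δ x w.1, μ x w.2) ∈ tensorGraph μ τ := by
  set L : D × E →L[ℂ] D × E := (δ x).prodMap (μ x)
  have : tensorGraph μ τ ≤ (tensorGraph μ τ).comap (L : D × E →ₗ[ℂ] _) := by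
    refine tensorGraph_le ?_ fun a b => ?_
    · exact (Submodule.isClosed_topologicalClosure _).preimage L.continuous
    · have h : L (τ a b, μ a b) = (τ (μ x a) b, μ (μ x a) b) := by
        rw [hμ, ← hτ]; rfl
      change L (τ a b, μ a b) ∈ tensorGraph μ τ
      rw [h]
      exact mem_tensorGraph _ _
  exact this hw

/-- The action `x · (b, u, z) = (0, x ⊗ b + x · u, x b + x z)` of `E` on `E × D × E`. -/
noncomputable def freeAct (μ : E →L[ℂ] E →L[ℂ] E) (τ : E →L[ℂ] E →L[ℂ] D)
    (δ : E →L[ℂ] D →L[ℂ] D) : E →L[ℂ] (E × D × E) →L[ℂ] (E × D × E) :=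
  (ContinuousLinearMap.compL ℂ (E × D × E) (D × E) _ (ContinuousLinearMap.inr ℂ E _)).comp
    ((ContinuousLinearMap.compL ℂ (E × D × E) D _ (ContinuousLinearMap.inl ℂ _ E)).comp
      (τ.bilinearComp (.id ℂ E) (ContinuousLinearMap.fst ℂ _ _) +
        δ.bilinearComp (.id ℂ E)
          ((ContinuousLinearMap.fst ℂ _ _).comp (ContinuousLinearMap.snd ℂ _ _))) +
     (ContinuousLinearMap.compL ℂ (E × D × E) E _ (ContinuousLinearMap.inr ℂ _ E)).comp
      (μ.bilinearComp (.id ℂ E) (ContinuousLinearMap.fst ℂ _ _ +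
          (ContinuousLinearMap.snd ℂ _ _).comp (ContinuousLinearMap.snd ℂ _ _))))

theorem freeAct_apply (δ : E →L[ℂ] D →L[ℂ] D) (x : E) (y : E × D × E) :
    freeAct μ τ δ x y = (0, τ x y.1 + δ x y.2.1, μ x y.1 + μ x y.2.2) := by
  simp [freeAct]

/-- A projective `E` admits a bounded map `W` to the completion of `E ⊗ E` which on products is a
morphism of modules and a right inverse of the product map. -/
theorem IsProjectiveFor.exists_splitting [CompleteSpace E] [CompleteSpace D]
    (hμ : ∀ a b c, μ (μ a b) c = μ a (μ b c)) (hproj : IsProjectiveFor μ)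
    {δ : E →L[ℂ] D →L[ℂ] D} (hδ : ∀ a b u, δ (μ a b) u = δ a (δ b u))
    (hτ : ∀ x a b, δ x (τ a b) = τ (μ x a) b) :
    ∃ W : E →L[ℂ] D,
      (∀ z, W z ∈ (Submodule.span ℂ {u | ∃ a b : E, u = τ a b}).topologicalClosure) ∧
      (∀ x y, (W (μ x y), μ x y) ∈ tensorGraph μ τ) ∧
      (∀ y, ∃ b u, ∀ x, W (μ x y) = τ x b + δ x u) := by
  -- A triple `(b, u, z)` stands for `1 ⊗ b + u`, with a unit adjoined to the left factor and `z`
  -- the product of `u`. Multiplication is then `b + z`, with linear right inverse `x ↦ 1 ⊗ x`.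
  -- After acting by an element of `E` no `1 ⊗ b` term remains, so on products the middle coordinate
  -- of the lift is already a splitting.
  obtain ⟨ψ, hψS, hψ, hφψ⟩ := hproj.exists_lift (freeAct μ τ δ)
    (fun a b y => by simp [freeAct_apply, hμ, hδ, hτ])
    (ContinuousLinearMap.fst ℂ E (D × E) +
      (ContinuousLinearMap.snd ℂ D E).comp (ContinuousLinearMap.snd ℂ E (D × E)))
    (fun a y => by rw [freeAct_apply]; simp)
    ((tensorGraph μ τ).comap (LinearMap.snd ℂ E (D × E)))
    ((Submodule.isClosed_topologicalClosure _).preimage continuous_snd)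
    (fun x y hy => by
      have h1 : y.2 ∈ tensorGraph μ τ := hy
      change (freeAct μ τ δ x y).2 ∈ tensorGraph μ τ
      rw [freeAct_apply]
      exact add_mem (mem_tensorGraph x y.1) (act_mem_tensorGraph hμ hτ x h1))
    (ContinuousLinearMap.inl ℂ E (D × E))
    (fun x => (tensorGraph μ τ).zero_mem)
    (fun x => add_zero x)
  have hψS' : ∀ x, (ψ x).2 ∈ tensorGraph μ τ := hψS
  refine ⟨(ContinuousLinearMap.fst ℂ D E).comp ((ContinuousLinearMap.snd ℂ E (D × E)).comp ψ),
    fun z => tensorGraph_fst_mem (hψS' z), fun x y => ?_, fun y => ⟨(ψ y).1, (ψ y).2.1, ?_⟩⟩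
  · have h : (ψ (μ x y)).1 + (ψ (μ x y)).2.2 = μ x y := hφψ (μ x y)
    have h0 : (ψ (μ x y)).1 = 0 := by rw [hψ, freeAct_apply]
    rw [h0, zero_add] at h
    have h2 := hψS' (μ x y)
    rwa [← Prod.mk.eta (p := (ψ (μ x y)).2), h] at h2
  · intro x
    change (ψ (μ x y)).2.1 = _
    rw [hψ, freeAct_apply]

end ProjectiveSplitting

/-! ### Splittings tested on bilinear forms -/

section BilinearForms

set_option maxSynthPendingDepth 3

variable {E : Type u} [NormedAddCommGroup E] [NormedSpace ℂ E]

/-- The dual of the space of bounded bilinear forms on `E`. -/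
abbrev BilinFormDual (E : Type u) [NormedAddCommGroup E] [NormedSpace ℂ E] : Type u :=
  (E →L[ℂ] E →L[ℂ] ℂ) →L[ℂ] ℂ

/-- The elementary tensor `a ⊗ b`, as the functional `β ↦ β a b` on bounded bilinear forms. -/
noncomputable def elemTensor : E →L[ℂ] E →L[ℂ] BilinFormDual E :=
  ((ContinuousLinearMap.compL ℂ (E →L[ℂ] E →L[ℂ] ℂ) (E →L[ℂ] ℂ) ℂ).bilinearComp
    (ContinuousLinearMap.apply ℂ ℂ) (ContinuousLinearMap.apply ℂ (E →L[ℂ] ℂ))).flip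

@[simp]
theorem elemTensor_apply (a b : E) (β : E →L[ℂ] E →L[ℂ] ℂ) : elemTensor a b β = β a b := rfl

/-- The action `x · u` of `x` on a functional `u` which extends `x · (a ⊗ b) = μ x a ⊗ b`. -/
noncomputable def bilinFormDualAct (μ : E →L[ℂ] E →L[ℂ] E) :
    E →L[ℂ] BilinFormDual E →L[ℂ] BilinFormDual E :=
  (ContinuousLinearMap.compL ℂ (E →L[ℂ] E →L[ℂ] ℂ) (E →L[ℂ] E →L[ℂ] ℂ) ℂ).flip.comp
    ((ContinuousLinearMap.compL ℂ E E (E →L[ℂ] ℂ)).flip.comp μ)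

@[simp]
theorem bilinFormDualAct_apply (μ : E →L[ℂ] E →L[ℂ] E) (x : E) (u : BilinFormDual E)
    (β : E →L[ℂ] E →L[ℂ] ℂ) : bilinFormDualAct μ x u β = u (β.comp (μ x)) := rfl

/-- `W` takes values in the completion of `E ⊗ E`, and on the products it is a right inverse of the
product map and depends on the first factor `x` only through the forms `β x` and `β (μ x ·)`. -/
structure IsBilinSplitting (μ : E →L[ℂ] E →L[ℂ] E) (W : E →L[ℂ] BilinFormDual E) : Prop where
  mem_closure : ∀ z, W z ∈ (Submodule.span ℂ {u | ∃ a b : E, u = elemTensor a b}).topologicalClosure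
  apply_mul : ∀ x y (β : E →L[ℂ] E →L[ℂ] ℂ) (f : E →L[ℂ] ℂ), (∀ a b, β a b = f (μ a b)) →
    W (μ x y) β = f (μ x y)
  congr_left : ∀ x x' y (β : E →L[ℂ] E →L[ℂ] ℂ), β x = β x' → (∀ a, β (μ x a) = β (μ x' a)) →
    W (μ x y) β = W (μ x' y) β

/-- `apply_mul` comes from membership in the graph, and `congr_left` from the formula `W (μ x y) = x
⊗ b + x · u`, in which `b` and `u` depend on `y` only. -/
theorem IsProjectiveFor.exists_isBilinSplitting [CompleteSpace E] {μ : E →L[ℂ] E →L[ℂ] E}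
    (hμ : ∀ a b c, μ (μ a b) c = μ a (μ b c)) (hproj : IsProjectiveFor μ) :
    ∃ W : E →L[ℂ] BilinFormDual E, IsBilinSplitting μ W := by
  have hδ : ∀ a b u, bilinFormDualAct μ (μ a b) u =
      bilinFormDualAct μ a (bilinFormDualAct μ b u) := by
    intro a b u
    ext β
    have h : β.comp (μ (μ a b)) = (β.comp (μ a)).comp (μ b) :=
      ContinuousLinearMap.ext fun c => by simp [hμ]
    simp [h]
  obtain ⟨W, h1, h2, h3⟩ := hproj.exists_splitting hμ hδ (τ := elemTensor) (fun x a b => rfl)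
  refine ⟨W, h1, fun x y β f hf => ?_, fun x x' y β hx ha => ?_⟩
  · exact tensorGraph_apply (h2 x y) (ContinuousLinearMap.apply ℂ ℂ β) f hf
  · obtain ⟨b, u, h⟩ := h3 y
    have hc : β.comp (μ x) = β.comp (μ x') := ContinuousLinearMap.ext ha
    rw [h, h]
    simp [hx, hc]

/-- The closed span of the products `μ x y`. -/
noncomputable def closedProductSpan (μ : E →L[ℂ] E →L[ℂ] E) : Submodule ℂ E :=
  (Submodule.span ℂ {z | ∃ x y, z = μ x y}).topologicalClosure

variable {μ : E →L[ℂ] E →L[ℂ] E}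

theorem mul_mem_closedProductSpan (x y : E) : μ x y ∈ closedProductSpan μ :=
  Submodule.le_topologicalClosure _ (Submodule.subset_span ⟨x, y, rfl⟩)

theorem closedProductSpan_le {S : Submodule ℂ E} (hS : IsClosed (S : Set E))
    (h : ∀ x y, μ x y ∈ S) : closedProductSpan μ ≤ S := by
  refine Submodule.topologicalClosure_minimal _ (Submodule.span_le.2 ?_) hS
  rintro _ ⟨x, y, rfl⟩
  exact h x y

theorem eqOn_closedProductSpan {L L' : E →L[ℂ] ℂ} (h : ∀ x y, L (μ x y) = L' (μ x y)) {z : E}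
    (hz : z ∈ closedProductSpan μ) : L z = L' z := by
  have : closedProductSpan μ ≤ (L - L').toLinearMap.ker :=
    closedProductSpan_le (L - L').isClosed_ker fun x y => sub_eq_zero.2 (h x y)
  exact sub_eq_zero.1 (this hz)

theorem map_mem_closedProductSpan {T : E →L[ℂ] E} (hT : ∀ x y, T (μ x y) = μ (T x) y) {z : E}
    (hz : z ∈ closedProductSpan μ) : T z ∈ closedProductSpan μ := by
  have : closedProductSpan μ ≤ (closedProductSpan μ).comap T.toLinearMap := by
    refine closedProductSpan_le ?_ fun x y => ?_
    · exact (Submodule.isClosed_topologicalClosure _).preimage T.continuous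
    · change T (μ x y) ∈ closedProductSpan μ
      rw [hT]
      exact mul_mem_closedProductSpan _ _
  exact this hz

namespace IsBilinSplitting

variable {W : E →L[ℂ] BilinFormDual E}

theorem apply_eq (hW : IsBilinSplitting μ W) {β : E →L[ℂ] E →L[ℂ] ℂ} {f : E →L[ℂ] ℂ}
    (h : ∀ a b, β a b = f (μ a b)) {z : E} (hz : z ∈ closedProductSpan μ) : W z β = f z :=
  eqOn_closedProductSpan (L := (ContinuousLinearMap.apply ℂ ℂ β).comp W) (L' := f)
    (fun x y => hW.apply_mul x y β f h) hz

/-- On a product, `T` moves to the first factor, where `congr_left` lets it be replaced by the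
scalar `k`: apply `hβ` to `x` and to `μ x a`. Continuity does the rest. -/
theorem apply_map (hW : IsBilinSplitting μ W) {T : E →L[ℂ] E} (hT : ∀ x y, T (μ x y) = μ (T x) y)
    {k : ℂ} {β : E →L[ℂ] E →L[ℂ] ℂ} (hβ : ∀ x, β (T x) = β (k • x)) {z : E}
    (hz : z ∈ closedProductSpan μ) : W (T z) β = k * W z β := by
  refine eqOn_closedProductSpan (L := ((ContinuousLinearMap.apply ℂ ℂ β).comp W).comp T)
    (L' := k • (ContinuousLinearMap.apply ℂ ℂ β).comp W) (fun x y => ?_) hz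
  change W (T (μ x y)) β = k • W (μ x y) β
  have h : W (μ (T x) y) β = W (μ (k • x) y) β := by
    refine hW.congr_left _ _ y β (hβ x) fun a => ?_
    rw [← hT, hβ, map_smul, map_smul, smul_apply, map_smul]
  rw [hT, h, map_smul, smul_apply, map_smul, smul_apply]

/-- The forms vary only pointwise continuously, which is too weak for an arbitrary functional. But
`W z` is a norm limit of finite sums of elementary tensors, uniformly on forms of norm at most one.
-/
theorem continuous_apply (hW : IsBilinSplitting μ W) {X : Type*} [TopologicalSpace X]
    {β : X → E →L[ℂ] E →L[ℂ] ℂ} (hβ : ∀ a b, Continuous fun q => β q a b) (h1 : ∀ q, ‖β q‖ ≤ 1)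
    (z : E) : Continuous fun q => W z (β q) := by
  have hcont : ∀ u ∈ Submodule.span ℂ {u | ∃ a b : E, u = elemTensor a b},
      Continuous fun q => u (β q) := by
    intro u hu
    induction hu using Submodule.span_induction with
    | mem u hu =>
      obtain ⟨a, b, rfl⟩ := hu
      exact hβ a b
    | zero => exact continuous_const
    | add u u' _ _ ih ih' => exact ih.add ih'
    | smul k u _ ih => exact ih.const_smul k
  refine continuous_of_uniform_approx_of_continuous fun N hN => ?_
  obtain ⟨ε, hε, hεN⟩ := Metric.mem_uniformity_dist.1 hN
  obtain ⟨u, hu, huW⟩ := Metric.mem_closure_iff.1 (hW.mem_closure z) ε hε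
  refine ⟨fun q => u (β q), hcont u hu, fun q => hεN ?_⟩
  rw [dist_eq_norm] at huW ⊢
  exact ((W z - u).unit_le_opNorm _ (h1 q)).trans_lt huW

end IsBilinSplitting

end BilinearForms

section Regular

variable {A : Type u} [NonUnitalNormedRing A] [NormedSpace ℂ A] [IsScalarTower ℂ A A]
  [SMulCommClass ℂ A A] [CompleteSpace A]

theorem IsLeftProjectiveBanachAlgebra.isProjectiveFor (h : IsLeftProjectiveBanachAlgebra A) :
    IsProjectiveFor (ContinuousLinearMap.mul ℂ A) :=
  fun Y _ _ _ m φ hm hφ hσ => h Y ⟨m, hm⟩ φ hφ hσ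

theorem IsRightProjectiveBanachAlgebra.isProjectiveFor (h : IsRightProjectiveBanachAlgebra A) :
    IsProjectiveFor (ContinuousLinearMap.mul ℂ A).flip :=
  fun Y _ _ _ m φ hm hφ hσ => h Y ⟨m, fun a b y => hm b a y⟩ φ hφ hσ

end Regular

/-! ### Paracompactness from a symmetric relation -/

section Paracompact

/-- A space that is covered by the classes of an equivalence relation with open paracompact classes
is paracompact. -/
theorem ParacompactSpace.of_isOpen_classes {X : Type*} [TopologicalSpace X] (r : Setoid X)
    (ho : ∀ x, IsOpen {y | r x y}) (hp : ∀ x, ParacompactSpace {y | r x y}) :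
    ParacompactSpace X := by
  refine ⟨fun α s hs hcov => ?_⟩
  have key : ∀ q : Quotient r, ∃ t : α → Set X, (∀ a, IsOpen (t a)) ∧
      (⋃ a, t a) = {y | r q.out y} ∧ (∀ x, r q.out x → ∃ N ∈ 𝓝 x, {a | (t a ∩ N).Nonempty}.Finite) ∧
      ∀ a, t a ⊆ s a := by
    intro q
    have := hp q.out
    set C : Set X := {y | r q.out y} with hC
    have hCo : IsOpen C := ho q.out
    obtain ⟨t, hto, htc, htf, hts⟩ := precise_refinement (fun a => ((↑) : C → X) ⁻¹' s a)
      (fun a => (hs a).preimage continuous_subtype_val)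
      (by rw [← Set.preimage_iUnion, hcov, Set.preimage_univ])
    refine ⟨fun a => (↑) '' t a, fun a => hCo.isOpenMap_subtype_val _ (hto a), ?_, ?_, ?_⟩
    · rw [← Set.image_iUnion, htc, Set.image_univ, Subtype.range_coe]
    · intro x hx
      obtain ⟨N, hN, hfin⟩ := htf ⟨x, hx⟩
      refine ⟨(↑) '' N, hCo.isOpenMap_subtype_val.image_mem_nhds hN, hfin.subset ?_⟩
      rintro a ⟨_, ⟨y, hy, rfl⟩, ⟨z, hz, hzy⟩⟩
      exact ⟨y, hy, Subtype.ext hzy ▸ hz⟩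
    · rintro a _ ⟨y, hy, rfl⟩
      exact hts a hy
  choose t hto htc htf hts using key
  refine ⟨Quotient r × α, fun i => t i.1 i.2, fun i => hto _ _, ?_, ?_, fun i => ⟨i.2, hts _ _⟩⟩
  · refine Set.eq_univ_of_forall fun x => ?_
    have hx : x ∈ ⋃ a, t ⟦x⟧ a := by rw [htc]; exact Quotient.exact (Quotient.out_eq _)
    obtain ⟨a, ha⟩ := Set.mem_iUnion.1 hx
    exact Set.mem_iUnion.2 ⟨(⟦x⟧, a), ha⟩
  · intro x
    have hx : r (⟦x⟧ : Quotient r).out x := Quotient.exact (Quotient.out_eq _)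
    obtain ⟨N, hN, hfin⟩ := htf ⟦x⟧ x hx
    -- Inside the class of `x`, only the refinement chosen for that class can be met.
    refine ⟨N ∩ {y | r x y}, inter_mem hN ((ho x).mem_nhds (r.refl x)),
      (hfin.image fun a => ((⟦x⟧ : Quotient r), a)).subset ?_⟩
    rintro ⟨q, a⟩ ⟨y, hy, hyN, hxy⟩
    have hy' : r q.out y := by
      have : y ∈ ⋃ a, t q a := Set.mem_iUnion.2 ⟨a, hy⟩
      rwa [htc] at this
    have hq : q = ⟦x⟧ := by
      rw [← Quotient.out_eq q]
      exact Quotient.sound (r.trans hy' (r.symm hxy))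
    subst hq
    exact ⟨a, ⟨y, hy, hyN⟩, rfl⟩

/-- A locally compact Hausdorff space is paracompact if it carries a symmetric relation that is a
neighbourhood of each point and carries compact sets into compact sets. -/
theorem ParacompactSpace.of_symmetric_relation {X : Type*} [TopologicalSpace X] [T2Space X]
    [LocallyCompactSpace X] (R : X → X → Prop) (hsymm : ∀ x y, R x y → R y x)
    (hnhds : ∀ x, ∀ᶠ y in 𝓝 x, R x y)
    (hcomp : ∀ K : Set X, IsCompact K → ∃ L, IsCompact L ∧ ∀ x ∈ K, ∀ y, R x y → y ∈ L) :
    ParacompactSpace X := by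
  have hs : ∀ {x y}, Relation.ReflTransGen R x y → Relation.ReflTransGen R y x :=
    fun h => (@Relation.ReflTransGen.stdSymm _ R ⟨hsymm⟩).symm _ _ h
  let r : Setoid X := ⟨Relation.ReflTransGen R,
    ⟨fun _ => .refl, fun h => hs h, fun h h' => h.trans h'⟩⟩
  have ho : ∀ x, IsOpen {y | r x y} := by
    intro x
    refine isOpen_iff_mem_nhds.2 fun y hy => ?_
    filter_upwards [hnhds y] with z hz
    exact Relation.ReflTransGen.tail hy hz
  have hcl : ∀ x, IsClosed {y | r x y} := by
    intro x
    refine ⟨isOpen_iff_mem_nhds.2 fun y hy => ?_⟩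
    filter_upwards [(ho y).mem_nhds (r.refl y)] with z hz hxz
    exact hy (r.trans hxz (r.symm hz))
  refine ParacompactSpace.of_isOpen_classes r ho fun x => ?_
  -- Iterating `L` from `{x}` exhausts the class of `x` by countably many compact sets.
  choose! L hLc hL using hcomp
  have hKc : ∀ n : ℕ, IsCompact (L^[n] {x}) := by
    intro n
    induction n with
    | zero => exact isCompact_singleton
    | succ n ih => rw [Function.iterate_succ_apply']; exact hLc _ ih
  have hsub : ∀ y, Relation.ReflTransGen R x y → ∃ n : ℕ, y ∈ L^[n] {x} := by
    intro y hy
    induction hy with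
    | refl => exact ⟨0, rfl⟩
    | tail _ hbc ih =>
      obtain ⟨n, hn⟩ := ih
      exact ⟨n + 1, by rw [Function.iterate_succ_apply']; exact hL _ (hKc n) _ hn _ hbc⟩
  have hσ : IsSigmaCompact {y | r x y} := by
    refine ⟨fun n => L^[n] {x} ∩ {y | r x y}, fun n => (hKc n).inter_right (hcl x), ?_⟩
    rw [← Set.iUnion_inter]
    exact Set.inter_eq_right.2 fun y hy => Set.mem_iUnion.2 (hsub y hy)
  have : SigmaCompactSpace {y | r x y} := isSigmaCompact_iff_sigmaCompactSpace.1 hσ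
  have : LocallyCompactSpace {y | r x y} := (ho x).locallyCompactSpace
  infer_instance

end Paracompact

/-! ### Left and right multiplication treated together -/

section MulOrFlip

/-- The product of an algebra (`c = true`) or of its opposite (`c = false`). -/
noncomputable def mulOrFlip (c : Bool) (R : Type*) [NonUnitalNormedRing R] [NormedSpace ℂ R]
    [IsScalarTower ℂ R R] [SMulCommClass ℂ R R] : R →L[ℂ] R →L[ℂ] R :=
  if c then ContinuousLinearMap.mul ℂ R else (ContinuousLinearMap.mul ℂ R).flip

variable {R : Type*} [NonUnitalNormedRing R] [NormedSpace ℂ R]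
    [IsScalarTower ℂ R R] [SMulCommClass ℂ R R] (c : Bool)

theorem mulOrFlip_apply (a b : R) : mulOrFlip c R a b = if c then a * b else b * a := by
  cases c <;> rfl

theorem mulOrFlip_assoc (a b d : R) :
    mulOrFlip c R (mulOrFlip c R a b) d = mulOrFlip c R a (mulOrFlip c R b d) := by
  cases c <;> simp [mulOrFlip_apply, mul_assoc]

theorem norm_mulOrFlip_le (a b : R) : ‖mulOrFlip c R a b‖ ≤ ‖a‖ * ‖b‖ := by
  cases c
  · rw [mul_comm]; exact norm_mul_le b a
  · exact norm_mul_le a b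

end MulOrFlip

/-! ### Bump functions and localization in the section algebra -/

namespace ContinuousField

section Bump

/-- A continuous compactly supported function with values in `[0, 1]`. -/
structure IsBump {Ω : Type*} [TopologicalSpace Ω] (h : C(Ω, ℝ)) : Prop where
  hasCompactSupport : HasCompactSupport h
  mem_Icc : ∀ t, h t ∈ Set.Icc (0 : ℝ) 1

theorem IsBump.norm_le_one {Ω : Type*} [TopologicalSpace Ω] {h : C(Ω, ℝ)} (hh : IsBump h) (t : Ω) :
    ‖(h t : ℂ)‖ ≤ 1 := by
  rw [Complex.norm_real, Real.norm_eq_abs, abs_of_nonneg (hh.mem_Icc t).1]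
  exact (hh.mem_Icc t).2

theorem exists_isBump_eq_one {Ω : Type*} [TopologicalSpace Ω] [T2Space Ω] [LocallyCompactSpace Ω]
    {K : Set Ω} (hK : IsCompact K) : ∃ h : C(Ω, ℝ), IsBump h ∧ ∀ t ∈ K, h t = 1 := by
  obtain ⟨f, h1, -, hc, hI⟩ :=
    exists_continuous_one_zero_of_isCompact hK isClosed_empty (Set.disjoint_empty K)
  exact ⟨f, ⟨hc, hI⟩, fun t ht => h1 ht⟩

end Bump

variable {Ω : Type u} [TopologicalSpace Ω] {A : Ω → Type v}
  [∀ t, NonUnitalNormedRing (A t)] [∀ t, NormedSpace ℂ (A t)]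

theorem smul_mem_Θ (U : ContinuousField Ω A) {g : Ω → ℂ} (hg : Continuous g) {x : ∀ t, A t}
    (hx : x ∈ U.Θ) : (fun t => g t • x t) ∈ U.Θ := by
  refine U.mem_of_locally_approx _ fun t ε hε => ⟨g t • x, U.Θ.smul_mem _ hx, ?_⟩
  have hc : Continuous fun s => ‖g s - g t‖ * ‖x s‖ :=
    ((hg.sub continuous_const).norm).mul (U.continuous_norm x hx)
  filter_upwards [hc.continuousAt.eventually_lt (continuousAt_const (y := ε)) (by simpa using hε)]
    with s hs
  rw [Pi.smul_apply, ← sub_smul, norm_smul]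
  exact hs.le

variable [∀ t, IsScalarTower ℂ (A t) (A t)] [∀ t, SMulCommClass ℂ (A t) (A t)]
  (U : ContinuousField Ω A)

/-- Evaluation at `t`. -/
noncomputable def eval (t : Ω) : U.sectionAlgebra →L[ℂ] A t :=
  LinearMap.mkContinuous
    { toFun := fun x => (x : lp A ∞) t
      map_add' := fun _ _ => rfl
      map_smul' := fun _ _ => rfl } 1 fun x => by
    rw [one_mul]; exact lp.norm_apply_le_norm ENNReal.top_ne_zero (x : lp A ∞) t

variable {U}

theorem norm_eval_le (t : Ω) (x : U.sectionAlgebra) : ‖U.eval t x‖ ≤ ‖x‖ :=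
  lp.norm_apply_le_norm ENNReal.top_ne_zero (x : lp A ∞) t

theorem eval_mem_Θ (x : U.sectionAlgebra) : (fun t => U.eval t x) ∈ U.Θ := x.2.1

theorem tendsto_norm_eval (x : U.sectionAlgebra) :
    Tendsto (fun t => ‖U.eval t x‖) (cocompact Ω) (𝓝 0) := x.2.2

theorem ext_eval {x y : U.sectionAlgebra} (h : ∀ t, U.eval t x = U.eval t y) : x = y :=
  Subtype.ext (lp.ext (funext h))

theorem norm_le_of_eval_le {x : U.sectionAlgebra} {C : ℝ} (hC : 0 ≤ C)
    (h : ∀ t, ‖U.eval t x‖ ≤ C) : ‖x‖ ≤ C :=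
  lp.norm_le_of_forall_le hC h

theorem eval_mulOrFlip (c : Bool) (t : Ω) (x y : U.sectionAlgebra) :
    U.eval t (mulOrFlip c U.sectionAlgebra x y) =
      mulOrFlip c (A t) (U.eval t x) (U.eval t y) := by
  cases c <;> rfl

variable [T2Space Ω]

/-- The product of a continuous vector field with a bump function. -/
noncomputable def cutoff (U : ContinuousField Ω A) {h : C(Ω, ℝ)} (hh : IsBump h) {x : ∀ t, A t}
    (hx : x ∈ U.Θ) : U.sectionAlgebra :=
  have h1 : (fun t => (h t : ℂ) • x t) ∈ U.Θ :=
    U.smul_mem_Θ (Complex.continuous_ofReal.comp h.continuous) hx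
  have h2 : Tendsto (fun t => ‖(h t : ℂ) • x t‖) (cocompact Ω) (𝓝 0) := by
    refine tendsto_const_nhds.congr' ?_
    have := hasCompactSupport_iff_eventuallyEq.1 hh.hasCompactSupport
    rw [coclosedCompact_eq_cocompact] at this
    filter_upwards [this] with t ht
    simp [ht]
  ⟨⟨fun t => (h t : ℂ) • x t, U.memℓp_of_vanishing h1 h2⟩, h1, h2⟩

@[simp]
theorem eval_cutoff {h : C(Ω, ℝ)} (hh : IsBump h) {x : ∀ t, A t} (hx : x ∈ U.Θ) (t : Ω) :
    U.eval t (U.cutoff hh hx) = (h t : ℂ) • x t := rfl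

/-- Multiplication by a bump function on the section algebra. -/
noncomputable def bumpMul (U : ContinuousField Ω A) {h : C(Ω, ℝ)} (hh : IsBump h) :
    U.sectionAlgebra →L[ℂ] U.sectionAlgebra :=
  LinearMap.mkContinuous
    { toFun := fun x => U.cutoff hh (eval_mem_Θ x)
      map_add' := fun x y => ext_eval fun t => by simp
      map_smul' := fun k x => ext_eval fun t => by simp [smul_comm k] } 1 fun x => by
    rw [one_mul]
    refine norm_le_of_eval_le (norm_nonneg x) fun t => ?_
    change ‖(h t : ℂ) • U.eval t x‖ ≤ ‖x‖
    rw [norm_smul]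
    exact (mul_le_of_le_one_left (norm_nonneg _) (hh.norm_le_one t)).trans (norm_eval_le t x)

@[simp]
theorem eval_bumpMul {h : C(Ω, ℝ)} (hh : IsBump h) (x : U.sectionAlgebra) (t : Ω) :
    U.eval t (U.bumpMul hh x) = (h t : ℂ) • U.eval t x := rfl

theorem bumpMul_mulOrFlip (c : Bool) {h : C(Ω, ℝ)} (hh : IsBump h) (x y : U.sectionAlgebra) :
    U.bumpMul hh (mulOrFlip c _ x y) = mulOrFlip c _ (U.bumpMul hh x) y :=
  ext_eval fun t => by simp [eval_mulOrFlip]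

theorem thetaSq_le {q : ∀ t, A t} (hq : q ∈ U.thetaSq) : q ∈ U.Θ := by
  refine Submodule.span_induction ?_ (zero_mem _) (fun _ _ _ _ h h' => add_mem h h')
    (fun k _ _ h => U.Θ.smul_mem k h) hq
  rintro _ ⟨x, hx, y, hy, rfl⟩
  exact mul_mem hx hy

/-- The closed span of the products in the section algebra. -/
noncomputable abbrev closedProducts (U : ContinuousField Ω A) (c : Bool) :
    Submodule ℂ U.sectionAlgebra :=
  closedProductSpan (mulOrFlip c U.sectionAlgebra)

theorem mul_mem_closedProducts (c : Bool) (x y : U.sectionAlgebra) :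
    mulOrFlip c _ x y ∈ U.closedProducts c :=
  mul_mem_closedProductSpan x y

theorem bumpMul_mem_closedProducts {c : Bool} {h : C(Ω, ℝ)} (hh : IsBump h) {z : U.sectionAlgebra}
    (hz : z ∈ U.closedProducts c) : U.bumpMul hh z ∈ U.closedProducts c :=
  map_mem_closedProductSpan (bumpMul_mulOrFlip c hh) hz

/-- The field `h² p`, as an element of the section algebra. -/
noncomputable def localize (U : ContinuousField Ω A) {h : C(Ω, ℝ)} (hh : IsBump h) {p : ∀ t, A t}
    (hp : p ∈ U.Θ) : U.sectionAlgebra := U.bumpMul hh (U.cutoff hh hp)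

theorem bumpMul_localize_comm {h h' : C(Ω, ℝ)} (hh : IsBump h) (hh' : IsBump h') {p : ∀ t, A t}
    (hp : p ∈ U.Θ) : U.bumpMul hh' (U.bumpMul hh' (U.localize hh hp)) =
      U.bumpMul hh (U.bumpMul hh (U.localize hh' hp)) := by
  refine ext_eval fun t => ?_
  simp only [localize, eval_bumpMul, eval_cutoff, smul_smul]
  ring_nf

/-- This is why the localization uses `h²`: `h² x y = (h x) (h y)` is a product of two elements of
the section algebra, even if `x` and `y` do not vanish at infinity. -/
theorem localize_mem_closedProducts_of_thetaSq (c : Bool) {h : C(Ω, ℝ)} (hh : IsBump h) {q : ∀ t, A t}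
    (hq : q ∈ U.thetaSq) : U.localize hh (thetaSq_le hq) ∈ U.closedProducts c := by
  suffices ∃ z ∈ U.closedProducts c, ∀ t, U.eval t z = (h t : ℂ) • (h t : ℂ) • q t by
    obtain ⟨z, hz, hzq⟩ := this
    have : U.localize hh (thetaSq_le hq) = z := ext_eval fun t => (hzq t).symm
    exact this ▸ hz
  induction hq using Submodule.span_induction with
  | mem q hq =>
    obtain ⟨x, hx, y, hy, rfl⟩ := hq
    cases c
    -- The opposite product takes the factors in reverse order.
    · refine ⟨_, mul_mem_closedProducts false (U.cutoff hh hy) (U.cutoff hh hx), fun t => ?_⟩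
      rw [eval_mulOrFlip, mulOrFlip_apply, eval_cutoff, eval_cutoff]
      simp only [Bool.false_eq_true, if_false, smul_mul_assoc, mul_smul_comm, Pi.mul_apply]
    · refine ⟨_, mul_mem_closedProducts true (U.cutoff hh hx) (U.cutoff hh hy), fun t => ?_⟩
      rw [eval_mulOrFlip, mulOrFlip_apply, eval_cutoff, eval_cutoff]
      simp only [if_true, smul_mul_assoc, mul_smul_comm, Pi.mul_apply]
  | zero => exact ⟨0, zero_mem _, fun t => by simp⟩
  | add q q' _ _ ih ih' =>
    obtain ⟨z, hz, hzq⟩ := ih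
    obtain ⟨z', hz', hzq'⟩ := ih'
    exact ⟨z + z', add_mem hz hz', fun t => by simp [hzq, hzq']⟩
  | smul k q _ ih =>
    obtain ⟨z, hz, hzq⟩ := ih
    exact ⟨k • z, Submodule.smul_mem _ _ hz, fun t => by simp [hzq, smul_comm k]⟩

/-- Since `h` has compact support, approximating `p` on that support approximates `h² p` in the
supremum norm. -/
theorem localize_mem_closedProducts (c : Bool) {h : C(Ω, ℝ)} (hh : IsBump h) {p : ∀ t, A t}
    (hpΘ : p ∈ U.Θ) (hp : p ∈ U.closureThetaSq) : U.localize hh hpΘ ∈ U.closedProducts c := by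
  have hcl : IsClosed (U.closedProducts c : Set U.sectionAlgebra) :=
    Submodule.isClosed_topologicalClosure _
  refine hcl.closure_subset (Metric.mem_closure_iff.2 fun ε hε => ?_)
  obtain ⟨q, hq, hpq⟩ := hp (tsupport h) hh.hasCompactSupport (ε / 2) (by positivity)
  refine ⟨_, localize_mem_closedProducts_of_thetaSq c hh hq, ?_⟩
  rw [dist_eq_norm]
  refine (norm_le_of_eval_le (half_pos hε).le fun t => ?_).trans_lt (half_lt_self hε)
  have ht : U.eval t (U.localize hh hpΘ - U.localize hh (thetaSq_le hq)) =
      (h t : ℂ) • (h t : ℂ) • (p t - q t) := by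
    rw [map_sub, smul_sub, smul_sub]; rfl
  rw [ht, norm_smul, norm_smul]
  by_cases hts : t ∈ tsupport h
  · have h1 := hh.norm_le_one t
    have h2 := hpq t hts
    calc _ ≤ 1 * (1 * (ε / 2)) := by gcongr
      _ = ε / 2 := by ring
  · simp [image_eq_zero_of_notMem_tsupport hts, (half_pos hε).le]

end ContinuousField

namespace ContinuousField

/-! ### The linking relation and its two estimates -/

section Separation

set_option maxSynthPendingDepth 3

variable {Ω : Type u} [TopologicalSpace Ω] {A : Ω → Type v}
  [∀ t, NonUnitalNormedRing (A t)] [∀ t, NormedSpace ℂ (A t)]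
  [∀ t, IsScalarTower ℂ (A t) (A t)] [∀ t, SMulCommClass ℂ (A t) (A t)]
  {U : ContinuousField Ω A}

/-- The bilinear forms `β` on the section algebra with `‖β a b‖ ≤ ‖a s‖ ‖b t‖`. -/
def fiberForms (U : ContinuousField Ω A) (s t : Ω) :
    Set (U.sectionAlgebra →L[ℂ] U.sectionAlgebra →L[ℂ] ℂ) :=
  {β | ∀ a b, ‖β a b‖ ≤ ‖U.eval s a‖ * ‖U.eval t b‖}

variable {s t : Ω} {β : U.sectionAlgebra →L[ℂ] U.sectionAlgebra →L[ℂ] ℂ}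

theorem norm_le_one_of_mem_fiberForms (hβ : β ∈ U.fiberForms s t) : ‖β‖ ≤ 1 := by
  refine ContinuousLinearMap.opNorm_le_bound₂ _ zero_le_one fun a b => ?_
  rw [one_mul]
  exact (hβ a b).trans
    (mul_le_mul (norm_eval_le s a) (norm_eval_le t b) (norm_nonneg _) (norm_nonneg _))

theorem eq_of_mem_fiberForms (hβ : β ∈ U.fiberForms s t) {x x' : U.sectionAlgebra}
    (h : U.eval s x = U.eval s x') : β x = β x' := by
  refine ContinuousLinearMap.ext fun b => ?_
  have h1 := hβ (x - x') b
  rw [map_sub (U.eval s), h, sub_self, norm_zero, zero_mul, map_sub] at h1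
  exact sub_eq_zero.1 (norm_le_zero_iff.1 h1)

variable [T2Space Ω] {c : Bool} {W : U.sectionAlgebra →L[ℂ] BilinFormDual U.sectionAlgebra}

/-- The form sees its first argument only at `s`, where multiplication by `h` is the scalar `h s`.
-/
theorem splitting_bumpMul (hW : IsBilinSplitting (mulOrFlip c U.sectionAlgebra) W)
    {h : C(Ω, ℝ)} (hh : IsBump h) (hβ : β ∈ U.fiberForms s t) {z : U.sectionAlgebra}
    (hz : z ∈ U.closedProducts c) : W (U.bumpMul hh z) β = (h s : ℂ) * W z β :=
  hW.apply_map (bumpMul_mulOrFlip c hh)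
    (fun x => eq_of_mem_fiberForms hβ (by rw [map_smul, eval_bumpMul])) hz

-- Multiplying by a bump equal to `1` at `s` does not change the value, so both sides equal the
-- value at `h² h'² p`.
set_option maxHeartbeats 1000000 in
theorem splitting_localize_eq (hW : IsBilinSplitting (mulOrFlip c U.sectionAlgebra) W)
    {p : ∀ t, A t} (hpΘ : p ∈ U.Θ) (hp : p ∈ U.closureThetaSq)
    {h h' : C(Ω, ℝ)} (hh : IsBump h) (hh' : IsBump h') (hs : h s = 1) (hs' : h' s = 1)
    (hβ : β ∈ U.fiberForms s t) : W (U.localize hh hpΘ) β = W (U.localize hh' hpΘ) β := by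
  have hz := localize_mem_closedProducts c hh hpΘ hp
  have hz' := localize_mem_closedProducts c hh' hpΘ hp
  have e (k : C(Ω, ℝ)) (hk : IsBump k) (hks : k s = 1) (z : U.sectionAlgebra)
      (hz : z ∈ U.closedProducts c) : W (U.bumpMul hk z) β = W z β := by
    rw [splitting_bumpMul hW hk hβ hz, hks, Complex.ofReal_one, one_mul]
  rw [← e h' hh' hs' _ hz, ← e h' hh' hs' _ (bumpMul_mem_closedProducts hh' hz),
    bumpMul_localize_comm, e h hh hs _ (bumpMul_mem_closedProducts hh hz'), e h hh hs _ hz']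

/-- For `a ⊗ b` take `g t = ‖a‖ ‖b t‖`. That `g` does not depend on `s` is what later gives one
compact set for all `s` in `K`. -/
theorem exists_tendsto_bound {u : BilinFormDual U.sectionAlgebra}
    (hu : u ∈ Submodule.span ℂ {u | ∃ a b : U.sectionAlgebra, u = elemTensor a b}) :
    ∃ g : Ω → ℝ, Tendsto g (cocompact Ω) (𝓝 0) ∧
      ∀ s t, ∀ β ∈ U.fiberForms s t, ‖u β‖ ≤ g t := by
  induction hu using Submodule.span_induction with
  | mem u hu =>
    obtain ⟨a, b, rfl⟩ := hu
    refine ⟨fun t => ‖a‖ * ‖U.eval t b‖, by simpa using (tendsto_norm_eval b).const_mul ‖a‖,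
      fun s t β hβ => ?_⟩
    exact (hβ a b).trans (mul_le_mul_of_nonneg_right (norm_eval_le s a) (norm_nonneg _))
  | zero => exact ⟨fun _ => 0, tendsto_const_nhds, fun s t β _ => by simp⟩
  | add u u' _ _ ih ih' =>
    obtain ⟨g, hg, h⟩ := ih
    obtain ⟨g', hg', h'⟩ := ih'
    exact ⟨fun t => g t + g' t, by simpa using hg.add hg', fun s t β hβ =>
      (norm_add_le (u β) (u' β)).trans (add_le_add (h s t β hβ) (h' s t β hβ))⟩
  | smul k u _ ih =>
    obtain ⟨g, hg, h⟩ := ih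
    refine ⟨fun t => ‖k‖ * g t, by simpa using hg.const_mul ‖k‖, fun s t β hβ => ?_⟩
    change ‖k • u β‖ ≤ _
    rw [norm_smul]
    exact mul_le_mul_of_nonneg_left (h s t β hβ) (norm_nonneg _)

/-- Some form in `fiberForms s t` takes on the splitting of `p`, localized near `s`, a value of more
than half the norm of `p s`. -/
def Linked (U : ContinuousField Ω A) (W : U.sectionAlgebra →L[ℂ] BilinFormDual U.sectionAlgebra)
    {p : ∀ t, A t} (hpΘ : p ∈ U.Θ) (s t : Ω) : Prop :=
  ∃ (h : C(Ω, ℝ)) (hh : IsBump h), h s = 1 ∧ ∃ β ∈ U.fiberForms s t,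
    ‖p s‖ / 2 < ‖W (U.localize hh hpΘ) β‖

theorem exists_isCompact_of_linked [LocallyCompactSpace Ω]
    (hW : IsBilinSplitting (mulOrFlip c U.sectionAlgebra) W)
    {p : ∀ t, A t} (hpΘ : p ∈ U.Θ) (hp : p ∈ U.closureThetaSq) (hp0 : ∀ t, p t ≠ 0)
    {K : Set Ω} (hK : IsCompact K) :
    ∃ L, IsCompact L ∧ ∀ s ∈ K, ∀ t, U.Linked W hpΘ s t → t ∈ L := by
  rcases K.eq_empty_or_nonempty with rfl | hne
  · exact ⟨∅, isCompact_empty, by simp⟩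
  obtain ⟨s₀, -, hmin⟩ := hK.exists_isMinOn hne (U.continuous_norm p hpΘ).continuousOn
  have hm : 0 < ‖p s₀‖ := norm_pos_iff.2 (hp0 s₀)
  obtain ⟨h, hh, h1⟩ := exists_isBump_eq_one hK
  -- With `m = ‖p s₀‖` the minimum over `K`, being linked requires a value above `m / 2`; outside
  -- `L` the approximation error and the bound `g` each contribute at most `m / 4`.
  obtain ⟨u, hu, huW⟩ := Metric.mem_closure_iff.1
    (hW.mem_closure (U.localize hh hpΘ)) (‖p s₀‖ / 4) (by positivity)
  obtain ⟨g, hg, hgu⟩ := exists_tendsto_bound hu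
  obtain ⟨L, hL, hLg⟩ :=
    mem_cocompact.1 (hg.eventually (gt_mem_nhds (show 0 < ‖p s₀‖ / 4 by positivity)))
  refine ⟨L, hL, fun s hs t => ?_⟩
  rintro ⟨h', hh', h1', β, hβ, hlt⟩
  by_contra ht
  have h2 : g t < ‖p s₀‖ / 4 := hLg ht
  have h3 : ‖p s₀‖ ≤ ‖p s‖ := hmin hs
  -- The bump that witnesses the link depends on `s`; it is exchanged for the one fixed on `K`.
  rw [splitting_localize_eq hW hpΘ hp hh' hh h1' (h1 s hs) hβ] at hlt
  rw [dist_eq_norm] at huW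
  have h4 : ‖W (U.localize hh hpΘ) β - u β‖ ≤ ‖p s₀‖ / 4 * 1 :=
    ((W (U.localize hh hpΘ) - u).le_opNorm β).trans
      (mul_le_mul huW.le (norm_le_one_of_mem_fiberForms hβ) (norm_nonneg _) (by positivity))
  have h5 := norm_sub_norm_le (W (U.localize hh hpΘ) β) (u β)
  have h6 := hgu s t β hβ
  linarith

/-- The bilinear form `f (φ (a s) · ψ (b t))`. -/
noncomputable def productForm (U : ContinuousField Ω A) (c : Bool) {B : Type*}
    [NonUnitalNormedRing B] [NormedSpace ℂ B] [IsScalarTower ℂ B B] [SMulCommClass ℂ B B]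
    (f : B →L[ℂ] ℂ) {s t : Ω} (φ : A s →L[ℂ] B) (ψ : A t →L[ℂ] B) :
    U.sectionAlgebra →L[ℂ] U.sectionAlgebra →L[ℂ] ℂ :=
  (ContinuousLinearMap.compL ℂ U.sectionAlgebra B ℂ f).comp
    ((mulOrFlip c B).bilinearComp (φ.comp (U.eval s)) (ψ.comp (U.eval t)))

/-- On the diagonal, multiplicativity of `φ` makes the form a functional of the product, so
`apply_eq` evaluates it. -/
theorem splitting_productForm (hW : IsBilinSplitting (mulOrFlip c U.sectionAlgebra) W) {B : Type*}
    [NonUnitalNormedRing B] [NormedSpace ℂ B] [IsScalarTower ℂ B B] [SMulCommClass ℂ B B]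
    (f : B →L[ℂ] ℂ) {s : Ω} (φ : A s →L[ℂ] B) (hφ : ∀ a b, φ (a * b) = φ a * φ b)
    {z : U.sectionAlgebra} (hz : z ∈ U.closedProducts c) :
    W z (U.productForm c f φ φ) = f (φ (U.eval s z)) := by
  refine hW.apply_eq (f := (f.comp φ).comp (U.eval s)) (fun a b => ?_) hz
  change f (mulOrFlip c B (φ (U.eval s a)) (φ (U.eval s b))) =
    f (φ (U.eval s (mulOrFlip c U.sectionAlgebra a b)))
  rw [eval_mulOrFlip, mulOrFlip_apply, mulOrFlip_apply]
  split_ifs <;> rw [hφ]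

theorem linked_near_diagonal [LocallyCompactSpace Ω] (hU : U.IsLocallyTrivial)
    (hW : IsBilinSplitting (mulOrFlip c U.sectionAlgebra) W)
    {p : ∀ t, A t} (hpΘ : p ∈ U.Θ) (hp : p ∈ U.closureThetaSq) (hp0 : ∀ t, p t ≠ 0) (s₀ : Ω) :
    ∀ᶠ t in 𝓝 s₀, U.Linked W hpΘ s₀ t ∧ U.Linked W hpΘ t s₀ := by
  obtain ⟨V, hV, hsV, B, _, _, _, _, _, ⟨i⟩⟩ := hU s₀
  obtain ⟨K, hK, hsK⟩ := exists_compact_mem_nhds s₀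
  obtain ⟨h, hh, h1⟩ := exists_isBump_eq_one hK
  let φ : ∀ t : V, A t →L[ℂ] B := fun t => ((i.φ t).toContinuousLinearEquiv : A t →L[ℂ] B)
  have hφn : ∀ (t : V) (a : A t), ‖φ t a‖ = ‖a‖ := fun t a => (i.φ t).norm_map a
  have hφc : ∀ x : U.sectionAlgebra, Continuous fun t : V => φ t (U.eval t x) := fun x =>
    (i.mem_iff fun t => U.eval t x).1 fun t₀ ε hε =>
      ⟨fun t => U.eval t x, eval_mem_Θ x, by simp [hε.le]⟩
  set s₁ : V := ⟨s₀, hsV⟩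
  -- Hahn–Banach in the common fibre `B`: a single norming functional at `s₀` is used for all nearby
  -- pairs.
  obtain ⟨f, hf1, hf⟩ := exists_dual_vector'' ℂ (φ s₁ (p s₀))
  let β : V × V → U.sectionAlgebra →L[ℂ] U.sectionAlgebra →L[ℂ] ℂ :=
    fun q => U.productForm c f (φ q.1) (φ q.2)
  have hβ : ∀ q : V × V, β q ∈ U.fiberForms q.1 q.2 := by
    intro q a b
    change ‖f (mulOrFlip c B (φ q.1 (U.eval q.1 a)) (φ q.2 (U.eval q.2 b)))‖ ≤ _
    refine (f.le_of_opNorm_le hf1 _).trans ?_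
    rw [one_mul, ← hφn q.1 (U.eval q.1 a), ← hφn q.2 (U.eval q.2 b)]
    exact norm_mulOrFlip_le c _ _
  have hβc : ∀ a b, Continuous fun q => β q a b := by
    intro a b
    change Continuous fun q : V × V =>
      f (mulOrFlip c B (φ q.1 (U.eval q.1 a)) (φ q.2 (U.eval q.2 b)))
    exact f.continuous.comp ((mulOrFlip c B).continuous₂.comp
      (((hφc a).comp continuous_fst).prodMk ((hφc b).comp continuous_snd)))
  set z := U.localize hh hpΘ with hz
  have hWcont : Continuous fun q => W z (β q) :=
    hW.continuous_apply hβc (fun q => norm_le_one_of_mem_fiberForms (hβ q)) z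
  have hdiag : ‖W z (β (s₁, s₁))‖ = ‖p s₀‖ := by
    have e : W z (β (s₁, s₁)) = f (φ s₁ (U.eval s₀ z)) :=
      splitting_productForm hW f (φ s₁) (i.map_mul s₁)
        (localize_mem_closedProducts c hh hpΘ hp)
    have e2 : U.eval s₀ z = p s₀ := by
      change (h s₀ : ℂ) • (h s₀ : ℂ) • p s₀ = p s₀
      rw [h1 s₀ (mem_of_mem_nhds hsK)]
      simp
    rw [e, e2, hf, hφn]
    simp
  have hpc : Continuous fun q : V × V => ‖p q.1‖ / 2 :=
    ((U.continuous_norm p hpΘ).comp (continuous_subtype_val.comp continuous_fst)).div_const 2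
  -- The inequality is strict at the diagonal point because `p s₀ ≠ 0`, and both sides are
  -- continuous.
  have hev : ∀ᶠ q in 𝓝 (s₁, s₁), ‖p q.1‖ / 2 < ‖W z (β q)‖ := by
    refine hpc.continuousAt.eventually_lt hWcont.norm.continuousAt ?_
    rw [hdiag]
    exact half_lt_self (norm_pos_iff.2 (hp0 s₀))
  have hK1 : ∀ᶠ q : V × V in 𝓝 (s₁, s₁), h q.1 = 1 := by
    have : Tendsto (fun q : V × V => (q.1 : Ω)) (𝓝 (s₁, s₁)) (𝓝 s₀) :=
      (continuous_subtype_val.comp continuous_fst).tendsto (s₁, s₁)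
    filter_upwards [this hsK] with q hq using h1 _ hq
  have hlink : ∀ᶠ q : V × V in 𝓝 (s₁, s₁), U.Linked W hpΘ q.1 q.2 := by
    filter_upwards [hev, hK1] with q hq hq1
    exact ⟨h, hh, hq1, β q, hβ q, hq⟩
  have ht1 : Tendsto (fun t : V => (s₁, t)) (𝓝 s₁) (𝓝 (s₁, s₁)) :=
    (continuous_const.prodMk continuous_id).tendsto s₁
  have ht2 : Tendsto (fun t : V => (t, s₁)) (𝓝 s₁) (𝓝 (s₁, s₁)) :=
    (continuous_id.prodMk continuous_const).tendsto s₁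
  have hfin := (ht1.eventually hlink).and (ht2.eventually hlink)
  rw [← map_nhds_subtype_coe_eq_nhds hsV (hV.mem_nhds hsV), eventually_map]
  exact hfin

/-- `Linked` need not be symmetric. Its symmetrization keeps the compactness property, being a
smaller relation, and still holds near the diagonal because that was shown in both orders. -/
theorem paracompactSpace_of_isProjectiveFor [LocallyCompactSpace Ω] [∀ t, CompleteSpace (A t)]
    (hU : U.IsLocallyTrivial) (hproj : IsProjectiveFor (mulOrFlip c U.sectionAlgebra))
    {p : ∀ t, A t} (hpΘ : p ∈ U.Θ) (hp : p ∈ U.closureThetaSq) (hp0 : ∀ t, p t ≠ 0) :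
    ParacompactSpace Ω := by
  obtain ⟨W, hW⟩ := hproj.exists_isBilinSplitting (mulOrFlip_assoc c)
  refine ParacompactSpace.of_symmetric_relation
    (fun s t => U.Linked W hpΘ s t ∧ U.Linked W hpΘ t s) (fun s t h => h.symm)
    (linked_near_diagonal hU hW hpΘ hp hp0) fun K hK => ?_
  obtain ⟨L, hL, h⟩ := exists_isCompact_of_linked hW hpΘ hp hp0 hK
  exact ⟨L, hL, fun s hs t hst => h s hs t hst.1⟩

end Separation

end ContinuousField

theorem theorem4p7 {Ω : Type*} [TopologicalSpace Ω] [T2Space Ω] [LocallyCompactSpace Ω]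
    {A : Ω → Type*} [∀ t, NonUnitalNormedRing (A t)] [∀ t, NormedSpace ℂ (A t)]
    [∀ t, IsScalarTower ℂ (A t) (A t)] [∀ t, SMulCommClass ℂ (A t) (A t)]
    [∀ t, CompleteSpace (A t)]
    (U : ContinuousField Ω A) (hU : U.IsLocallyTrivial)
    (hproj : IsLeftProjectiveBanachAlgebra U.sectionAlgebra ∨
      IsRightProjectiveBanachAlgebra U.sectionAlgebra)
    (p : ∀ t, A t) (hpΘ : p ∈ U.Θ) (hp : p ∈ U.closureThetaSq) (hp0 : ∀ t, p t ≠ 0)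
    (hpb : BddAbove (Set.range fun t => ‖p t‖)) :
    ParacompactSpace Ω := by
  rcases hproj with h | h
  · exact ContinuousField.paracompactSpace_of_isProjectiveFor (c := true) hU h.isProjectiveFor
      hpΘ hp hp0
  · exact ContinuousField.paracompactSpace_of_isProjectiveFor (c := false) hU h.isProjectiveFor
      hpΘ hp hp0
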